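/- Let $n\ge 2$ and $k\ge 0$ be integers, and let $$f(x)=\sum_{i=0}^{n}c_i\frac{x^i}{i!}\in\mathbb{Q}[x],$$ where $c_i\in\mathbb{Z}$ for all $0\le i\le n$, $c_n=1$, and $c_0=2^k$ or $c_0=-2^k$. Then the following hold. (i) Either $f$ is irreducible over $\mathbb{Q}$, or $$f(x)=g(x)\prod_{i=1}^{n-\deg g}\bigl(x+\varepsilon_i 2^{t_i}\bigr)$$ for some irreducible polynomial $g\in\mathbb{Q}[x]$, some signs $\varepsilon_i\in\{1,-1\}$ and some nonnegative integers $t_i$ $(1\le i\le n-\deg g)$, where $\frac n2<\deg g<n$ if $n\ge 3$, and $\deg g=1$ if $n=2$. (ii) If $n$ is not of the form $2^s$ with $s$ a positive integer, or if $c_0=\pm1$, then $f$ is irreducible over $\mathbb{Q}$. -/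

import Mathlib

open Polynomial

/-- The rational polynomial `∑_{i=0}^n c_i x^i / i!`. Only `c 0, …, c n` matter. -/
noncomputable def expSum (n : ℕ) (c : ℕ → ℤ) : ℚ[X] :=
  ∑ i ∈ Finset.range (n + 1), C ((c i : ℚ) / (Nat.factorial i : ℚ)) * X ^ i

/-!
The engine is Sylvester's theorem: if `0 < d` and `2 * d ≤ n`, then some prime `p > d` divides one
of `n, n - 1, …, n - d + 1`, say `p ∣ n - i`. Modulo `p` the polynomial `n! f` is then divisible by
`X ^ (n - i)`, while the cofactor of a monic factor of degree `d > i` has degree `n - d < n - i`;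
so `p` divides the constant term of this factor, which therefore has a root `α` in an algebraic
closure of `ℚ_[p]` with `‖α‖ < 1`. As `α` has degree at most `d ≤ p - 1` over `ℚ_[p]`, even
`‖α‖ ^ (p - 1) ≤ 1 / p`, and Legendre's formula gives `‖α ^ i‖ < ‖i!‖` for all `i ≥ 1`. Hence
`f(α) = 0` forces `p ∣ c 0`. When `c 0 = ± 2 ^ k` only linear factors escape this for `2 * d ≤ n`.

Sylvester's theorem is proved following Erdős: if every prime factor of `n.choose k` is at most
`k`, then `n.choose k` is too small, because its prime power factors are at most `n` and its prime
factors above `√n` occur to the first power only.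
-/

/-! ### Sylvester's theorem -/

theorem prod_pow_factorization_choose_le {n k m : ℕ} (hn : 0 < n) {S : Finset ℕ}
    (hS : S ⊆ Nat.primesLE m) :
    ∏ p ∈ S, p ^ (n.choose k).factorization p ≤ n ^ m.primeCounting :=
  calc ∏ p ∈ S, p ^ (n.choose k).factorization p ≤ ∏ _p ∈ S, n :=
        Finset.prod_le_prod' fun _ _ => Nat.pow_factorization_choose_le hn
    _ = n ^ S.card := Finset.prod_const n
    _ ≤ n ^ m.primeCounting := by
        rw [← Nat.primesLE_card_eq_primeCounting]
        exact Nat.pow_le_pow_right hn (Finset.card_le_card hS)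

theorem prod_primeFactors_pow_factorization {m : ℕ} (hm : m ≠ 0) :
    ∏ p ∈ m.primeFactors, p ^ m.factorization p = m := by
  rw [← Nat.prod_factorization_eq_prod_primeFactors, Nat.prod_factorization_pow_eq_self hm]

theorem choose_le_pow_primeCounting {n k : ℕ} (hn : 0 < n)
    (h : n.choose k ∈ Nat.smoothNumbers (k + 1)) : n.choose k ≤ n ^ k.primeCounting := by
  rw [← prod_primeFactors_pow_factorization (Nat.ne_zero_of_mem_smoothNumbers h)]
  exact prod_pow_factorization_choose_le hn (Nat.primeFactors_subset_of_mem_smoothNumbers h)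

theorem choose_mul_pow_le {a n : ℕ} (han : a ≤ n) (j : ℕ) :
    a.choose j * n ^ j ≤ n.choose j * a ^ j := by
  have key : a.descFactorial j * n ^ j ≤ n.descFactorial j * a ^ j := by
    simp only [Nat.descFactorial_eq_prod_range, Finset.pow_eq_prod_const, ← Finset.prod_mul_distrib]
    refine Finset.prod_le_prod' fun i _ => ?_
    rw [Nat.sub_mul, Nat.sub_mul, mul_comm n a]
    exact Nat.sub_le_sub_left (Nat.mul_le_mul_left i han) _
  rw [Nat.descFactorial_eq_factorial_mul_choose, Nat.descFactorial_eq_factorial_mul_choose,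
    mul_assoc, mul_assoc] at key
  exact Nat.le_of_mul_le_mul_left key j.factorial_pos

theorem pow_sub_primeCounting_le {n k : ℕ} (hn : 0 < n) (hkn : k ≤ n)
    (h : n.choose k ∈ Nat.smoothNumbers (k + 1)) : n ^ (k - k.primeCounting) ≤ k ^ k := by
  have hpi : k.primeCounting ≤ k := by
    rw [← Nat.primesLE_card_eq_primeCounting, Nat.primesLE_eq_filter_Icc_one]
    exact (Finset.card_filter_le _ _).trans (by simp)
  refine le_of_mul_le_mul_left (a := n ^ k.primeCounting) ?_ (by positivity)
  calc n ^ k.primeCounting * n ^ (k - k.primeCounting) = k.choose k * n ^ k := by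
        rw [← pow_add, Nat.add_sub_cancel' hpi, Nat.choose_self, one_mul]
    _ ≤ n.choose k * k ^ k := choose_mul_pow_le hkn k
    _ ≤ n ^ k.primeCounting * k ^ k := Nat.mul_le_mul_right _ (choose_le_pow_primeCounting hn h)

theorem three_mul_primeCounting_le {k : ℕ} (hk : 37 ≤ k) : 3 * k.primeCounting ≤ k := by
  rcases lt_or_ge k 160 with h | h
  · have small : ∀ k < 160, 37 ≤ k → 3 * k.primeCounting ≤ k := by decide +kernel
    exact small k h hk
  · have h1 := Nat.primeCounting_add_le (a := 30) (k := 37) (by norm_num) (by norm_num) (k - 37)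
    have h2 : Nat.primeCounting 37 = 12 := by decide +kernel
    have h3 : Nat.totient 30 = 8 := by decide +kernel
    rw [Nat.add_sub_cancel' hk, h2, h3] at h1
    lia

theorem sq_le_cube_of_choose_mem_smoothNumbers {n k : ℕ} (hk : 37 ≤ k) (hkn : k ≤ n)
    (h : n.choose k ∈ Nat.smoothNumbers (k + 1)) : n ^ 2 ≤ k ^ 3 := by
  have hn : 0 < n := by lia
  have hpi := three_mul_primeCounting_le hk
  refine (Nat.pow_le_pow_iff_left (n := k) (by lia)).1 ?_
  calc (n ^ 2) ^ k = n ^ (2 * k) := by rw [← pow_mul]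
    _ ≤ n ^ (3 * (k - k.primeCounting)) := Nat.pow_le_pow_right hn (by lia)
    _ = (n ^ (k - k.primeCounting)) ^ 3 := by rw [← pow_mul, mul_comm]
    _ ≤ (k ^ k) ^ 3 := Nat.pow_le_pow_left (pow_sub_primeCounting_le hn hkn h) 3
    _ = (k ^ 3) ^ k := by rw [← pow_mul, ← pow_mul, mul_comm]

theorem le_div_three_of_prime_dvd_choose {n k p : ℕ} (hp : p.Prime) (hp2 : p ≠ 2) (hpk : p ≤ k)
    (hkn : 2 * k ≤ n) (hd : p ∣ n.choose k) : p ≤ n / 3 := by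
  by_contra! hlt
  have h0 := Nat.factorization_choose_of_lt_three_mul (n := n) hp2 hpk (by lia) (by lia)
  exact (hp.factorization_pos_of_dvd (Nat.choose_ne_zero (by lia)) hd).ne' h0

theorem choose_le_pow_mul_four_pow {n k : ℕ} (hn : 9 ≤ n) (hkn : 2 * k ≤ n)
    (h : n.choose k ∈ Nat.smoothNumbers (k + 1)) :
    n.choose k ≤ n ^ n.sqrt.primeCounting * 4 ^ min k (n / 3) := by
  set S := (n.choose k).primeFactors
  have hS : ∀ p ∈ S, p.Prime ∧ p ∣ n.choose k ∧ p ≤ k := fun p hp =>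
    ⟨Nat.prime_of_mem_primeFactors hp, Nat.dvd_of_mem_primeFactors hp,
      Nat.lt_succ_iff.1 (Nat.mem_primesBelow.1
        (Nat.primeFactors_subset_of_mem_smoothNumbers h hp)).1⟩
  have hsmall : ∏ p ∈ S with p ≤ n.sqrt, p ^ (n.choose k).factorization p ≤
      n ^ n.sqrt.primeCounting := by
    refine prod_pow_factorization_choose_le (by lia) fun p hp => ?_
    obtain ⟨hp, hps⟩ := Finset.mem_filter.1 hp
    exact Nat.mem_primesLE.2 ⟨hps, (hS p hp).1⟩
  have hlarge : ∏ p ∈ S with ¬p ≤ n.sqrt, p ^ (n.choose k).factorization p ≤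
      ∏ p ∈ S with ¬p ≤ n.sqrt, p := by
    refine Finset.prod_le_prod' fun p hp => ?_
    obtain ⟨hp, hps⟩ := Finset.mem_filter.1 hp
    have := Nat.factorization_choose_le_one (k := k) (Nat.sqrt_lt'.1 (not_le.1 hps))
    exact (Nat.pow_le_pow_right (hS p hp).1.pos this).trans_eq (pow_one p)
  have hprimorial : ∏ p ∈ S with ¬p ≤ n.sqrt, p ≤ primorial (min k (n / 3)) := by
    rw [primorial_eq_prod_primesLE]
    refine Finset.prod_le_prod_of_subset_of_one_le' (fun p hp => ?_)
      (fun p hp _ => (Nat.prime_of_mem_primesLE hp).one_lt.le)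
    obtain ⟨hp, hps⟩ := Finset.mem_filter.1 hp
    obtain ⟨hp, hd, hpk⟩ := hS p hp
    have h3 : 3 ≤ n.sqrt := Nat.le_sqrt.2 hn
    exact Nat.mem_primesLE.2
      ⟨le_min hpk (le_div_three_of_prime_dvd_choose hp (by lia) hpk hkn hd), hp⟩
  rw [← prod_primeFactors_pow_factorization (Nat.ne_zero_of_mem_smoothNumbers h),
    ← Finset.prod_filter_mul_prod_filter_not S (· ≤ n.sqrt)]
  exact Nat.mul_le_mul hsmall (hlarge.trans (hprimorial.trans (primorial_le_four_pow _)))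

theorem choose_le_choose_of_le_half {n i j : ℕ} (hij : i ≤ j) (hj : 2 * j ≤ n) :
    n.choose i ≤ n.choose j := by
  induction j, hij using Nat.le_induction with
  | base => exact le_rfl
  | succ j _ ih => exact (ih (by lia)).trans (Nat.choose_le_succ_of_lt_half_left (by lia))

theorem four_pow_mul_pow_le {n j : ℕ} (hj : 0 < j) (hjn : 2 * j ≤ n) :
    4 ^ j * n ^ j ≤ n * (n.choose j * (2 * j) ^ j) :=
  calc 4 ^ j * n ^ j ≤ 2 * j * ((2 * j).choose j * n ^ j) := by
        rw [← mul_assoc]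
        exact Nat.mul_le_mul_right _ (Nat.four_pow_le_two_mul_self_mul_centralBinom j hj)
    _ ≤ n * (n.choose j * (2 * j) ^ j) := Nat.mul_le_mul hjn (choose_mul_pow_le hjn j)

theorem pow_min_le_of_choose_mem_smoothNumbers {n k : ℕ} (hn : 9 ≤ n) (hk : 0 < k)
    (hkn : 2 * k ≤ n) (h : n.choose k ∈ Nat.smoothNumbers (k + 1)) :
    n ^ min k (n / 3) ≤ n ^ (n.sqrt.primeCounting + 1) * (2 * min k (n / 3)) ^ min k (n / 3) := by
  have hbound := choose_le_pow_mul_four_pow hn hkn h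
  set j := min k (n / 3)
  have hchoose : n.choose j ≤ n ^ n.sqrt.primeCounting * 4 ^ j :=
    (choose_le_choose_of_le_half (min_le_left _ _) hkn).trans hbound
  refine le_of_mul_le_mul_left (a := 4 ^ j) ?_ (by positivity)
  calc 4 ^ j * n ^ j ≤ n * (n.choose j * (2 * j) ^ j) := four_pow_mul_pow_le (by lia) (by lia)
    _ ≤ n * (n ^ n.sqrt.primeCounting * 4 ^ j * (2 * j) ^ j) := by gcongr
    _ = 4 ^ j * (n ^ (n.sqrt.primeCounting + 1) * (2 * j) ^ j) := by ring

theorem cube_mul_log_lt_negMulLog_two_div_sq {z : ℝ} (hz : 10 / 3 ≤ z) :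
    z ^ 3 * (3 * Real.log z) < z ^ 6 / 2 * Real.negMulLog (2 / z ^ 2) := by
  have hz0 : 0 < z := by linarith
  have hlog2 := Real.log_two_lt_d9
  have hlogz : 1 ≤ Real.log z := by
    rw [Real.le_log_iff_exp_le hz0]
    exact Real.exp_one_lt_d9.le.trans (by linarith)
  calc z ^ 3 * (3 * Real.log z) < z ^ 3 * (z * (2 * Real.log z - Real.log 2)) :=
        mul_lt_mul_of_pos_left (by nlinarith) (by positivity)
    _ = z ^ 6 / 2 * Real.negMulLog (2 / z ^ 2) := by
        rw [Real.negMulLog, Real.log_div (by norm_num) (by positivity), Real.log_pow]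
        field_simp
        push_cast
        ring

theorem cube_mul_log_lt_negMulLog_two_thirds {z : ℝ} (hz : 10 / 3 ≤ z) :
    z ^ 3 * (3 * Real.log z) < z ^ 6 / 2 * Real.negMulLog (2 / 3) := by
  have hz0 : 0 < z := by linarith
  have hlog2 := Real.log_two_lt_d9
  have hlogz : Real.log z ≤ z / 4 + 2 * Real.log 2 - 1 := by
    have := Real.log_le_sub_one_of_pos (show 0 < z / 4 by positivity)
    rw [Real.log_div hz0.ne' (by norm_num), show (4 : ℝ) = 2 ^ 2 by norm_num, Real.log_pow] at this
    push_cast at this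
    linarith
  have hlog : 1 / 3 ≤ -Real.log (2 / 3) := by
    have := Real.log_le_sub_one_of_pos (show (0 : ℝ) < 2 / 3 by norm_num)
    linarith
  have hsq : 10 / 3 * (10 / 3) ≤ z * z := by gcongr
  calc z ^ 3 * (3 * Real.log z) < z ^ 3 * (z ^ 3 / 9) :=
        mul_lt_mul_of_pos_left (by nlinarith) (by positivity)
    _ ≤ z ^ 3 * (z ^ 3 / 3 * -Real.log (2 / 3)) :=
        mul_le_mul_of_nonneg_left (by nlinarith [pow_pos hz0 3]) (by positivity)
    _ = z ^ 6 / 2 * Real.negMulLog (2 / 3) := by rw [Real.negMulLog]; ring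

theorem cube_mul_log_lt_mul_log_div {z j : ℝ} (hz : 10 / 3 ≤ z) (hj : z ^ 4 ≤ j)
    (hj3 : 3 * j ≤ z ^ 6) : z ^ 3 * (3 * Real.log z) < j * Real.log (z ^ 6 / (2 * j)) := by
  have hz0 : 0 < z := by linarith
  have hj0 : 0 < j := lt_of_lt_of_le (by positivity) hj
  -- The right-hand side is `z ^ 6 / 2 * negMulLog (2 * j / z ^ 6)`; by concavity only the endpoints
  -- `j = z ^ 4` and `j = z ^ 6 / 3` matter.
  have hmem : 2 * j / z ^ 6 ∈ Set.Icc (2 / z ^ 2) (2 / 3) := by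
    constructor
    · rw [div_le_div_iff₀ (by positivity) (by positivity)]
      nlinarith [pow_pos hz0 2]
    · rw [div_le_div_iff₀ (by positivity) (by positivity)]
      linarith
  have hmin := Real.concaveOn_negMulLog.min_le_of_mem_Icc (Set.mem_Ici.2 (by positivity))
    (Set.mem_Ici.2 (by norm_num)) hmem
  calc z ^ 3 * (3 * Real.log z) < z ^ 6 / 2 * Real.negMulLog (2 * j / z ^ 6) := by
        rcases min_le_iff.1 hmin with h | h
        · exact (cube_mul_log_lt_negMulLog_two_div_sq hz).trans_le (by gcongr)
        · exact (cube_mul_log_lt_negMulLog_two_thirds hz).trans_le (by gcongr)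
    _ = j * Real.log (z ^ 6 / (2 * j)) := by
        rw [Real.negMulLog, ← inv_div (2 * j), Real.log_inv]
        field_simp

theorem pow_mul_two_mul_pow_lt {n j e : ℕ} (hn : 1372 ≤ n) (he : (2 * e) ^ 2 ≤ n)
    (hj : n ^ 2 ≤ j ^ 3) (hj3 : 3 * j ≤ n) : n ^ e * (2 * j) ^ j < n ^ j := by
  have hj0 : 0 < j := Nat.pos_of_ne_zero fun h => by simp [h] at hj; lia
  have hn0 : (0 : ℝ) < n := by exact_mod_cast (by lia : 0 < n)
  -- With `n = z ^ 6` the bounds on `e` and `j` read `2 * e ≤ z ^ 3` and `z ^ 4 ≤ j`, and the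
  -- threshold `1372 = ⌈(10 / 3) ^ 6⌉` reads `10 / 3 ≤ z`.
  obtain ⟨z, hz0, hz⟩ : ∃ z : ℝ, 0 < z ∧ z ^ 6 = n :=
    ⟨(n : ℝ) ^ ((6 : ℕ) : ℝ)⁻¹, by positivity, Real.rpow_inv_natCast_pow hn0.le (by norm_num)⟩
  have hz' : 10 / 3 ≤ z := by
    refine le_of_pow_le_pow_left₀ (n := 6) (by norm_num) hz0.le ?_
    rw [hz]
    exact le_trans (by norm_num) (show (1372 : ℝ) ≤ n by exact_mod_cast hn)
  have hzj : z ^ 4 ≤ j := by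
    refine le_of_pow_le_pow_left₀ (n := 3) (by norm_num) (by positivity) ?_
    calc (z ^ 4) ^ 3 = (n : ℝ) ^ 2 := by rw [← hz]; ring
      _ ≤ (j : ℝ) ^ 3 := by exact_mod_cast hj
  have hze : 2 * e ≤ z ^ 3 := by
    refine le_of_pow_le_pow_left₀ (n := 2) (by norm_num) (by positivity) ?_
    calc (2 * (e : ℝ)) ^ 2 ≤ n := by exact_mod_cast he
      _ = (z ^ 3) ^ 2 := by rw [← hz]; ring
  have hlogz : 0 ≤ Real.log z := Real.log_nonneg (by linarith)
  have key : e * Real.log n < j * (Real.log n - Real.log (2 * j)) := by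
    rw [← Real.log_div hn0.ne' (by positivity), ← hz]
    calc e * Real.log (z ^ 6) = 2 * e * (3 * Real.log z) := by rw [Real.log_pow]; push_cast; ring
      _ ≤ z ^ 3 * (3 * Real.log z) := by gcongr
      _ < j * Real.log (z ^ 6 / (2 * j)) :=
        cube_mul_log_lt_mul_log_div hz' hzj (by rw [hz]; exact_mod_cast hj3)
  have hlog : Real.log ((n : ℝ) ^ e * (2 * j) ^ j) < Real.log ((n : ℝ) ^ j) := by
    rw [Real.log_mul (by positivity) (by positivity), Real.log_pow, Real.log_pow, Real.log_pow]
    linarith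
  exact_mod_cast (Real.log_lt_log_iff (by positivity) (by positivity)).1 hlog

theorem lt_1372_of_choose_mem_smoothNumbers {n k : ℕ} (hk : 37 ≤ k) (hkn : 2 * k ≤ n)
    (h : n.choose k ∈ Nat.smoothNumbers (k + 1)) : n < 1372 := by
  by_contra! hn
  have hsqrt : 37 ≤ n.sqrt := Nat.le_sqrt.2 (by lia)
  have he : (2 * (n.sqrt.primeCounting + 1)) ^ 2 ≤ n := by
    refine (Nat.pow_le_pow_left ?_ 2).trans (Nat.sqrt_le' n)
    have := three_mul_primeCounting_le hsqrt
    lia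
  have hj : n ^ 2 ≤ min k (n / 3) ^ 3 := by
    rcases min_choice k (n / 3) with h' | h' <;> rw [h']
    · exact sq_le_cube_of_choose_mem_smoothNumbers hk (by lia) h
    · have : n ≤ 3 * (n / 3) + 2 := by lia
      have : 457 ≤ n / 3 := by lia
      nlinarith [sq_nonneg (n / 3)]
  exact (pow_min_le_of_choose_mem_smoothNumbers (by lia) (by lia) hkn h).not_gt
    (pow_mul_two_mul_pow_lt hn he hj (by lia))

theorem exists_prime_cube_sub_lt_sq {n : ℕ} (hn : 73 ≤ n) (hn' : n < 1372) :
    ∃ p, p.Prime ∧ p ≤ n ∧ (n - p) ^ 3 < n ^ 2 := by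
  let l : List ℕ := [73, 89, 113, 139, 167, 199, 233, 271, 317, 367, 421, 479, 541, 613, 691, 773,
    863, 953, 1051, 1153, 1259]
  have hl : ∀ p ∈ l, p.Prime := by norm_num [l]
  have cover : ∀ n < 1372, 73 ≤ n → l.any fun p => p ≤ n ∧ (n - p) ^ 3 < n ^ 2 := by
    decide +kernel
  obtain ⟨p, hp, h⟩ := List.any_eq_true.1 (cover n hn' hn)
  exact ⟨p, hl p hp, of_decide_eq_true h⟩

theorem exists_prime_dvd_sub_of_lt_37 {n k : ℕ} (hk : 0 < k) (hk' : k < 37) (hkn : 2 * k ≤ n)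
    (h : n.choose k ∈ Nat.smoothNumbers (k + 1)) : ∃ p, p.Prime ∧ k < p ∧ ∃ i < k, p ∣ n - i := by
  have hpow := pow_sub_primeCounting_le (by lia) (by lia) h
  have hn : n < 211 := by
    have bound : ∀ k < 37, 0 < k → k ^ k < 211 ^ (k - k.primeCounting) := by decide +kernel
    exact lt_of_pow_lt_pow_left₀ _ (by positivity) (hpow.trans_lt (bound k hk' hk))
  have table : ∀ k < 37, ∀ n < 211, 0 < k ∧ 2 * k ≤ n ∧ n ^ (k - k.primeCounting) ≤ k ^ k →
      ∃ i < k, ∃ p ∈ (n - i).primeFactorsList, k < p := by decide +kernel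
  obtain ⟨i, hi, p, hp, hkp⟩ := table k hk' n hn ⟨hk, hkn, hpow⟩
  exact ⟨p, Nat.prime_of_mem_primeFactorsList hp, hkp, i, hi, Nat.dvd_of_mem_primeFactorsList hp⟩

theorem exists_prime_dvd_sub_of_37_le {n k : ℕ} (hk : 37 ≤ k) (hkn : 2 * k ≤ n)
    (h : n.choose k ∈ Nat.smoothNumbers (k + 1)) : ∃ p, p.Prime ∧ k < p ∧ ∃ i < k, p ∣ n - i := by
  obtain ⟨p, hp, hpn, hcube⟩ :=
    exists_prime_cube_sub_lt_sq (by lia) (lt_1372_of_choose_mem_smoothNumbers hk hkn h)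
  have hlt : n - p < k := lt_of_pow_lt_pow_left₀ 3 k.zero_le
    (hcube.trans_le (sq_le_cube_of_choose_mem_smoothNumbers hk (by lia) h))
  exact ⟨p, hp, by lia, n - p, hlt, by rw [Nat.sub_sub_self hpn]⟩

theorem choose_mem_smoothNumbers {n k : ℕ} (h : ∀ p, p.Prime → k < p → ∀ i < k, ¬p ∣ n - i) :
    n.choose k ∈ Nat.smoothNumbers (k + 1) := by
  refine Nat.mem_smoothNumbers'.2 fun p hp hd => ?_
  by_contra! hkp
  have hdesc : p ∣ n.descFactorial k :=
    Nat.descFactorial_eq_factorial_mul_choose n k ▸ hd.mul_left _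
  rw [Nat.descFactorial_eq_prod_range, hp.prime.dvd_finsetProd_iff] at hdesc
  obtain ⟨i, hi, hdi⟩ := hdesc
  exact h p hp hkp i (Finset.mem_range.1 hi) hdi

theorem exists_prime_gt_dvd_sub {n k : ℕ} (hk : 0 < k) (hkn : 2 * k ≤ n) :
    ∃ p, p.Prime ∧ k < p ∧ ∃ i < k, p ∣ n - i := by
  by_contra! h
  have hsmooth := choose_mem_smoothNumbers h
  obtain ⟨p, hp, hkp, i, hi, hd⟩ := (lt_or_ge k 37).elim
    (exists_prime_dvd_sub_of_lt_37 hk · hkn hsmooth)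
    (exists_prime_dvd_sub_of_37_le · hkn hsmooth)
  exact h p hp hkp i hi hd

/-! ### Factors of `expSum n c` -/

/-- The integral polynomial `n! * ∑_{i=0}^n c_i x^i / i!`, with `n! / i!` written as the descending
factorial `n (n - 1) ⋯ (i + 1)`. -/
noncomputable def intExpSum (n : ℕ) (c : ℕ → ℤ) : ℤ[X] :=
  ∑ i ∈ Finset.range (n + 1), C (c i * n.descFactorial (n - i)) * X ^ i

theorem map_intExpSum (n : ℕ) (c : ℕ → ℤ) :
    (intExpSum n c).map (algebraMap ℤ ℚ) = C (n.factorial : ℚ) * expSum n c := by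
  rw [intExpSum, expSum, Polynomial.map_sum, Finset.mul_sum]
  refine Finset.sum_congr rfl fun i hi => ?_
  have hfac : (n.factorial : ℚ) = i.factorial * n.descFactorial (n - i) := by
    rw [← Nat.factorial_mul_descFactorial (Nat.sub_le n i),
      Nat.sub_sub_self (Finset.mem_range_succ_iff.1 hi), Nat.cast_mul]
  rw [Polynomial.map_mul, map_C, Polynomial.map_pow, map_X, ← mul_assoc, ← C_mul, hfac]
  have := i.factorial_ne_zero
  simp only [eq_intCast, Int.cast_mul, Int.cast_natCast]
  field_simp

theorem coeff_intExpSum {n i : ℕ} (c : ℕ → ℤ) (hi : i ≤ n) :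
    (intExpSum n c).coeff i = c i * n.descFactorial (n - i) := by
  simp only [intExpSum, finsetSum_coeff, coeff_C_mul_X_pow, Finset.sum_ite_eq,
    Finset.mem_range_succ_iff, if_pos hi]

theorem natDegree_intExpSum_le (n : ℕ) (c : ℕ → ℤ) : (intExpSum n c).natDegree ≤ n :=
  natDegree_sum_le_of_forall_le _ _ fun _ hi =>
    (natDegree_C_mul_X_pow_le _ _).trans (Finset.mem_range_succ_iff.1 hi)

theorem coeff_intExpSum_self (n : ℕ) (c : ℕ → ℤ) : (intExpSum n c).coeff n = c n := by
  rw [coeff_intExpSum c le_rfl, Nat.sub_self, Nat.descFactorial_zero, Nat.cast_one, mul_one]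

theorem monic_intExpSum {n : ℕ} {c : ℕ → ℤ} (hcn : c n = 1) : (intExpSum n c).Monic :=
  monic_of_natDegree_le_of_coeff_eq_one n (natDegree_intExpSum_le n c)
    (by rw [coeff_intExpSum_self, hcn])

theorem natDegree_intExpSum {n : ℕ} {c : ℕ → ℤ} (hcn : c n = 1) :
    (intExpSum n c).natDegree = n :=
  natDegree_eq_of_le_of_coeff_ne_zero (natDegree_intExpSum_le n c)
    (by rw [coeff_intExpSum_self, hcn]; exact one_ne_zero)

theorem natDegree_expSum {n : ℕ} {c : ℕ → ℤ} (hcn : c n = 1) : (expSum n c).natDegree = n := by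
  have h0 : (n.factorial : ℚ) ≠ 0 := by exact_mod_cast n.factorial_ne_zero
  rw [← natDegree_C_mul h0, ← map_intExpSum,
    natDegree_map_eq_of_injective (algebraMap ℤ ℚ).injective_int, natDegree_intExpSum hcn]

theorem dvd_coeff_intExpSum {n i d : ℕ} (c : ℕ → ℤ) (hd : d < n - i) :
    ((n - i : ℕ) : ℤ) ∣ (intExpSum n c).coeff d := by
  rw [coeff_intExpSum c (by lia)]
  refine Dvd.dvd.mul_left (Int.natCast_dvd_natCast.2 ?_) _
  rw [Nat.descFactorial_eq_prod_range]
  exact Finset.dvd_prod_of_mem _ (Finset.mem_range.2 (by lia))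

theorem exists_monic_dvd_intExpSum {n : ℕ} {c : ℕ → ℤ} (hcn : c n = 1) {a : ℚ[X]} (ha : a.Monic)
    (hdvd : a ∣ expSum n c) :
    ∃ G : ℤ[X], G.Monic ∧ G ∣ intExpSum n c ∧ G.map (algebraMap ℤ ℚ) = a := by
  have hinj := (algebraMap ℤ ℚ).injective_int
  have hdvd' : a ∣ (intExpSum n c).map (algebraMap ℤ ℚ) := map_intExpSum n c ▸ hdvd.mul_left _
  obtain ⟨G, hG⟩ := IsIntegrallyClosed.eq_map_mul_C_of_dvd ℚ (monic_intExpSum hcn) hdvd'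
  rw [ha.leadingCoeff, C_1, mul_one] at hG
  have hGm : G.Monic := monic_of_injective hinj (hG.symm ▸ ha)
  exact ⟨G, hGm, (map_dvd_map _ hinj hGm).1 (hG.symm ▸ hdvd'), hG⟩

theorem dvd_coeff_zero_of_dvd_coeff_mul {R : Type*} [CommRing R] {p : R} (hp : Prime p)
    {G H : R[X]} (hH : H.Monic) {r : ℕ} (hr : H.natDegree < r)
    (h : ∀ d < r, p ∣ (G * H).coeff d) : p ∣ G.coeff 0 := by
  have : (Ideal.span {p}).IsPrime := (Ideal.span_singleton_prime hp.ne_zero).2 hp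
  let φ := Ideal.Quotient.mk (Ideal.span {p})
  have hφ : ∀ a, φ a = 0 ↔ p ∣ a := fun a => by
    rw [Ideal.Quotient.eq_zero_iff_mem, Ideal.mem_span_singleton]
  by_contra h0
  have hX : ¬X ∣ G.map φ := by rwa [X_dvd_iff, coeff_map, hφ]
  have hXr : X ^ r ∣ G.map φ * H.map φ := by
    rw [← Polynomial.map_mul, X_pow_dvd_iff]
    exact fun d hd => by rw [coeff_map, hφ]; exact h d hd
  have hle := natDegree_le_of_dvd (prime_X.pow_dvd_of_dvd_mul_left r hX hXr) (hH.map φ).ne_zero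
  rw [natDegree_X_pow, hH.natDegree_map] at hle
  lia

theorem dvd_coeff_zero_of_dvd_intExpSum {n : ℕ} {c : ℕ → ℤ} (hcn : c n = 1) {p : ℕ}
    (hp : p.Prime) {G : ℤ[X]} (hG : G.Monic) (hdvd : G ∣ intExpSum n c) {i : ℕ}
    (hi : i < G.natDegree) (hpi : p ∣ n - i) : (p : ℤ) ∣ G.coeff 0 := by
  obtain ⟨H, hH⟩ := hdvd
  have hHm : H.Monic := hG.of_mul_monic_left (hH ▸ monic_intExpSum hcn)
  have hdeg : n = G.natDegree + H.natDegree := by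
    rw [← hG.natDegree_mul hHm, ← hH, natDegree_intExpSum hcn]
  refine dvd_coeff_zero_of_dvd_coeff_mul (Nat.prime_iff_prime_int.1 hp) hHm
    (show H.natDegree < n - i by lia) fun d hd => ?_
  rw [← hH]
  exact (Int.natCast_dvd_natCast.2 hpi).trans (dvd_coeff_intExpSum c hd)

theorem exists_isRoot_norm_lt_one {K : Type*} [NormedField K] [IsAlgClosed K] {P : K[X]}
    (hP : P.Monic) (h0 : ‖P.coeff 0‖ < 1) : ∃ x, P.IsRoot x ∧ ‖x‖ < 1 := by
  by_contra! h
  refine h0.not_ge ?_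
  rw [(IsAlgClosed.splits P).coeff_zero_eq_prod_roots_of_monic hP, norm_mul, norm_pow, norm_neg,
    norm_one, one_pow, one_mul]
  refine Multiset.prod_induction (fun x : K => 1 ≤ ‖x‖) _ (fun x y hx hy => ?_) norm_one.ge
    fun x hx => h x (isRoot_of_mem_roots hx)
  rw [norm_mul]
  exact one_le_mul_of_one_le_of_one_le hx hy

section Padic

variable {p : ℕ} [Fact p.Prime]

theorem norm_pow_le_inv_of_norm_lt_one {x : PadicAlgCl p} (hx : ‖x‖ < 1) {d : ℕ}
    (hd : (minpoly ℚ_[p] x).natDegree ≤ d) : ‖x‖ ^ d ≤ (p : ℝ)⁻¹ := by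
  have hpos : (minpoly ℚ_[p] x).natDegree ≠ 0 :=
    (minpoly.natDegree_pos (Algebra.IsIntegral.isIntegral x)).ne'
  have hpow : ‖x‖ ^ (minpoly ℚ_[p] x).natDegree = ‖(minpoly ℚ_[p] x).coeff 0‖ := by
    rw [← PadicAlgCl.spectralNorm_eq, spectralNorm.spectralNorm_eq_norm_coeff_zero_rpow, one_div,
      Real.rpow_inv_natCast_pow (norm_nonneg _) hpos]
  have hlt : ‖(minpoly ℚ_[p] x).coeff 0‖ < 1 := hpow ▸ pow_lt_one₀ (norm_nonneg x) hx hpos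
  calc ‖x‖ ^ d ≤ ‖x‖ ^ (minpoly ℚ_[p] x).natDegree :=
        pow_le_pow_of_le_one (norm_nonneg x) hx.le hd
    _ = ‖(minpoly ℚ_[p] x).coeff 0‖ := hpow
    _ ≤ (p : ℝ)⁻¹ := by
        have := (Padic.norm_le_pow_iff_norm_lt_pow_add_one ((minpoly ℚ_[p] x).coeff 0) (-1)).2
          (by simpa using hlt)
        simpa using this

theorem norm_pow_lt_norm_factorial {K : Type*} [NormedField K] [NormedAlgebra ℚ_[p] K]
    {x : K} (hx : ‖x‖ ^ (p - 1) ≤ (p : ℝ)⁻¹) {i : ℕ} (hi : i ≠ 0) :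
    ‖x ^ i‖ < ‖(i.factorial : K)‖ := by
  have hp := Fact.out (p := p.Prime)
  have hp1 : (p : ℝ)⁻¹ < 1 := inv_lt_one_of_one_lt₀ (by exact_mod_cast hp.one_lt)
  have hp0 : (0 : ℝ) < (p : ℝ)⁻¹ := inv_pos.2 (by exact_mod_cast hp.pos)
  have hfac : ‖(i.factorial : K)‖ = (p : ℝ)⁻¹ ^ padicValNat p i.factorial := by
    rw [← map_natCast (algebraMap ℚ_[p] K), norm_algebraMap',
      Padic.norm_eq_zpow_neg_valuation (by exact_mod_cast i.factorial_ne_zero),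
      Padic.valuation_natCast, zpow_neg, zpow_natCast, inv_pow]
  refine lt_of_pow_lt_pow_left₀ (p - 1) (norm_nonneg _) ?_
  calc ‖x ^ i‖ ^ (p - 1) = (‖x‖ ^ (p - 1)) ^ i := by rw [norm_pow, pow_right_comm]
    _ ≤ (p : ℝ)⁻¹ ^ i := by gcongr
    _ < (p : ℝ)⁻¹ ^ ((p - 1) * padicValNat p i.factorial) :=
        pow_lt_pow_right_of_lt_one₀ hp0 hp1 (sub_one_mul_padicValNat_factorial_lt_of_ne_zero p hi)
    _ = ‖(i.factorial : K)‖ ^ (p - 1) := by rw [hfac, ← pow_mul, mul_comm]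

theorem norm_aeval_expSum_eq_one {K : Type*} [NormedField K] [NormedAlgebra ℚ_[p] K] [CharZero K]
    [IsUltrametricDist K] {n : ℕ} {c : ℕ → ℤ} (hpc : ¬(p : ℤ) ∣ c 0) {x : K}
    (hx : ‖x‖ ^ (p - 1) ≤ (p : ℝ)⁻¹) : ‖aeval x (expSum n c)‖ = 1 := by
  have hint : ∀ m : ℤ, ‖(m : K)‖ = ‖(m : ℚ_[p])‖ := fun m => by
    rw [← map_intCast (algebraMap ℚ_[p] K), norm_algebraMap']
  have hzero : ‖(c 0 : K)‖ = 1 := by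
    rw [hint]
    exact le_antisymm (Padic.norm_int_le_one _) (not_lt.1 (mt Padic.norm_intCast_lt_one_iff.1 hpc))
  have hterm : ∀ i ∈ Finset.range n,
      ‖(c (i + 1) : K) * (x ^ (i + 1) / (i + 1).factorial)‖ < 1 := fun i _ => by
    have hlt := norm_pow_lt_norm_factorial hx i.succ_ne_zero
    rw [norm_mul, norm_div, hint]
    exact mul_lt_one_of_nonneg_of_lt_one_right (Padic.norm_int_le_one _) (by positivity)
      ((div_lt_one ((norm_nonneg _).trans_lt hlt)).2 hlt)
  have htail : ‖∑ i ∈ Finset.range n, (c (i + 1) : K) * (x ^ (i + 1) / (i + 1).factorial)‖ < 1 :=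
    Finset.sum_induction _ (‖·‖ < 1)
      (fun a b ha hb => (IsUltrametricDist.norm_add_le_max a b).trans_lt (max_lt ha hb))
      (norm_zero.trans_lt one_pos) hterm
  have heval : aeval x (expSum n c) =
      ∑ i ∈ Finset.range n, (c (i + 1) : K) * (x ^ (i + 1) / (i + 1).factorial) + c 0 := by
    simp only [expSum, map_sum, map_add, map_mul, aeval_C, map_div₀, map_intCast, map_natCast,
      map_pow, aeval_X, Finset.sum_range_succ', Nat.factorial_zero, Nat.cast_one, div_one, pow_zero,
      mul_one, div_mul_eq_mul_div, mul_div_assoc]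
  rw [heval, IsUltrametricDist.norm_add_eq_max_of_norm_ne_norm (by rw [hzero]; exact htail.ne),
    hzero, max_eq_right htail.le]

end Padic

theorem not_dvd_coeff_zero_of_map_dvd_expSum {n : ℕ} {c : ℕ → ℤ} {p : ℕ} (hp : p.Prime)
    (hpc : ¬(p : ℤ) ∣ c 0) {G : ℤ[X]} (hG : G.Monic) (hdvd : G.map (algebraMap ℤ ℚ) ∣ expSum n c)
    (hdeg : G.natDegree < p) : ¬(p : ℤ) ∣ G.coeff 0 := by
  intro hp0
  have := Fact.mk hp
  have hcoeff : ‖(G.map (algebraMap ℤ (PadicAlgCl p))).coeff 0‖ < 1 := by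
    rw [coeff_map, IsScalarTower.algebraMap_apply ℤ ℚ_[p], norm_algebraMap', eq_intCast]
    exact Padic.norm_intCast_lt_one_iff.2 hp0
  obtain ⟨x, hx, hx1⟩ := exists_isRoot_norm_lt_one (hG.map _) hcoeff
  have haeval : aeval x G = 0 := by rw [aeval_def, ← eval_map]; exact hx
  have hminpoly : (minpoly ℚ_[p] x).natDegree ≤ p - 1 := by
    have hle := natDegree_le_of_dvd (minpoly.dvd ℚ_[p] x (p := G.map (algebraMap ℤ ℚ_[p]))
      (by rw [aeval_map_algebraMap, haeval])) (hG.map _).ne_zero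
    rw [hG.natDegree_map] at hle
    lia
  have hroot : aeval x (expSum n c) = 0 :=
    aeval_eq_zero_of_dvd_aeval_eq_zero hdvd (by rw [aeval_map_algebraMap, haeval])
  have hnorm := norm_aeval_expSum_eq_one (n := n) hpc (norm_pow_le_inv_of_norm_lt_one hx1 hminpoly)
  rw [hroot, norm_zero] at hnorm
  exact zero_ne_one hnorm

theorem not_dvd_expSum {n : ℕ} {c : ℕ → ℤ} (hcn : c n = 1) {p : ℕ} (hp : p.Prime)
    (hpc : ¬(p : ℤ) ∣ c 0) {a : ℚ[X]} (ha : a.Monic) {i : ℕ} (hi : i < a.natDegree)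
    (hpi : p ∣ n - i) (hdeg : a.natDegree < p) : ¬a ∣ expSum n c := by
  intro hdvd
  obtain ⟨G, hG, hGd, rfl⟩ := exists_monic_dvd_intExpSum hcn ha hdvd
  rw [hG.natDegree_map] at hi hdeg
  exact not_dvd_coeff_zero_of_map_dvd_expSum hp hpc hG hdvd hdeg
    (dvd_coeff_zero_of_dvd_intExpSum hcn hp hG hGd hi hpi)

theorem not_dvd_expSum_of_prime_dvd_le {n : ℕ} {c : ℕ → ℤ} (hcn : c n = 1) {a : ℚ[X]}
    (ha : a.Monic) (hpos : 0 < a.natDegree) (hle : 2 * a.natDegree ≤ n)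
    (hc0 : ∀ p : ℕ, p.Prime → (p : ℤ) ∣ c 0 → p ≤ a.natDegree) : ¬a ∣ expSum n c := by
  obtain ⟨p, hp, hap, i, hi, hpi⟩ := exists_prime_gt_dvd_sub hpos hle
  exact not_dvd_expSum hcn hp (fun h => (hc0 p hp h).not_gt hap) ha hi hpi hap

theorem not_dvd_expSum_of_natDegree_eq_one {n : ℕ} {c : ℕ → ℤ} (hcn : c n = 1) {p : ℕ}
    (hp : p.Prime) (hpn : p ∣ n) (hpc : ¬(p : ℤ) ∣ c 0) {a : ℚ[X]} (ha : a.Monic)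
    (hdeg : a.natDegree = 1) : ¬a ∣ expSum n c :=
  not_dvd_expSum hcn hp hpc ha (i := 0) (by rw [hdeg]; exact one_pos) hpn
    (by rw [hdeg]; exact hp.one_lt)

theorem exists_eq_unit_mul_pow {z : ℤ} {q : ℕ} (hz : ∀ p : ℕ, p.Prime → (p : ℤ) ∣ z → p = q) :
    ∃ (ε : ℤˣ) (t : ℕ), z = ε * q ^ t := by
  have h0 : z ≠ 0 := by
    rintro rfl
    have h2 := hz 2 Nat.prime_two (dvd_zero _)
    have h3 := hz 3 Nat.prime_three (dvd_zero _)
    lia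
  have hpow := Nat.eq_prime_pow_of_unique_prime_dvd (Int.natAbs_ne_zero.2 h0)
    fun hp hd => hz _ hp (Int.natCast_dvd.2 hd)
  generalize z.natAbs.primeFactorsList.length = t at hpow
  rcases Int.natAbs_eq z with h | h <;> rw [hpow] at h
  · exact ⟨1, t, by simp [h]⟩
  · exact ⟨-1, t, by simp [h]⟩

theorem exists_prime_dvd_not_dvd {n q : ℕ} (hn : 1 < n) {z : ℤ}
    (hz : ∀ p : ℕ, p.Prime → (p : ℤ) ∣ z → p = q)
    (h : (¬∃ s : ℕ, 0 < s ∧ n = q ^ s) ∨ z = 1 ∨ z = -1) :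
    ∃ p : ℕ, p.Prime ∧ p ∣ n ∧ ¬(p : ℤ) ∣ z := by
  rcases h with hpow | hunit
  · by_contra! hdvd
    have hn' := Nat.eq_prime_pow_of_unique_prime_dvd (by lia)
      fun {p} hp hpn => hz p hp (hdvd p hp hpn)
    exact hpow ⟨_, Nat.pos_of_ne_zero fun h0 => by rw [h0] at hn'; lia, hn'⟩
  · obtain ⟨p, hp, hpn⟩ := Nat.exists_prime_and_dvd hn.ne'
    exact ⟨p, hp, hpn, fun hd => (Nat.prime_iff_prime_int.1 hp).not_isUnit
      (isUnit_of_dvd_unit hd (Int.isUnit_iff.2 hunit))⟩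

theorem exists_eq_X_add_C_of_dvd_expSum {n : ℕ} {c : ℕ → ℤ} (hcn : c n = 1) {q : ℕ}
    (hc0 : ∀ p : ℕ, p.Prime → (p : ℤ) ∣ c 0 → p = q) {a : ℚ[X]} (ha : a.Monic)
    (hdeg : a.natDegree = 1) (hdvd : a ∣ expSum n c) :
    ∃ (ε : ℤˣ) (t : ℕ), a = X + C (((ε : ℤ) : ℚ) * q ^ t) := by
  obtain ⟨G, hG, -, rfl⟩ := exists_monic_dvd_intExpSum hcn ha hdvd
  rw [hG.natDegree_map] at hdeg
  obtain ⟨ε, t, hεt⟩ : ∃ (ε : ℤˣ) (t : ℕ), G.coeff 0 = ε * q ^ t :=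
    exists_eq_unit_mul_pow fun p hp hpG => by
      by_contra hpq
      exact not_dvd_coeff_zero_of_map_dvd_expSum hp (mt (hc0 p hp) hpq) hG hdvd
        (hdeg ▸ hp.one_lt) hpG
  refine ⟨ε, t, ?_⟩
  rw [hG.eq_X_add_C hdeg, hεt, Polynomial.map_add, map_X, map_C, eq_intCast]
  push_cast
  rfl

section Field

variable {K : Type*} [Field K] {f : K[X]}

theorem exists_monic_linear_dvd_of_not_irreducible (hf : 0 < f.natDegree)
    (hno : ∀ q : K[X], q.Monic → 2 ≤ q.natDegree → 2 * q.natDegree ≤ f.natDegree → ¬q ∣ f)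
    (hirr : ¬Irreducible f) : ∃ q : K[X], q.Monic ∧ q.natDegree = 1 ∧ q ∣ f := by
  rw [irreducible_iff_lt_natDegree_lt (ne_zero_of_natDegree_gt hf)
    (not_isUnit_of_natDegree_pos f hf)] at hirr
  push Not at hirr
  obtain ⟨q, hq, hdeg, hqf⟩ := hirr
  rw [Finset.mem_Ioc] at hdeg
  exact ⟨q, hq, by_contra fun h1 => hno q hq (by lia) (by lia) hqf, hqf⟩

theorem exists_monic_linear_mul_irreducible (hf : 2 ≤ f.natDegree) (hf3 : f.natDegree ≠ 3)
    (hno : ∀ q : K[X], q.Monic → 2 ≤ q.natDegree → 2 * q.natDegree ≤ f.natDegree → ¬q ∣ f)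
    (hirr : ¬Irreducible f) :
    ∃ q g : K[X], q.Monic ∧ q.natDegree = 1 ∧ Irreducible g ∧ f = q * g := by
  obtain ⟨q, hq, hq1, g, rfl⟩ := exists_monic_linear_dvd_of_not_irreducible (by lia) hno hirr
  refine ⟨q, g, hq, hq1, ?_, rfl⟩
  have hg0 : g ≠ 0 := by rintro rfl; simp at hf
  rw [hq.natDegree_mul' hg0, hq1] at hf hf3 hno
  rcases (show g.natDegree = 1 ∨ 3 ≤ g.natDegree by lia) with hg1 | hg3
  · exact irreducible_of_degree_eq_one ((degree_eq_iff_natDegree_eq hg0).2 hg1)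
  by_contra hg
  obtain ⟨r, hr, hr1, hrg⟩ := exists_monic_linear_dvd_of_not_irreducible (by lia)
    (fun s hs h2 hle hsg => hno s hs h2 (by lia) (hsg.mul_left q)) hg
  have hqr : (q * r).natDegree = 2 := by rw [hq.natDegree_mul hr, hq1, hr1]
  exact hno (q * r) (hq.mul hr) hqr.ge (by lia) (mul_dvd_mul_left q hrg)

end Field

theorem not_dvd_expSum_of_two_le_natDegree {n : ℕ} {c : ℕ → ℤ} (hcn : c n = 1)
    (hc0 : ∀ p : ℕ, p.Prime → (p : ℤ) ∣ c 0 → p ≤ 2) {a : ℚ[X]} (ha : a.Monic)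
    (h2 : 2 ≤ a.natDegree) (hle : 2 * a.natDegree ≤ (expSum n c).natDegree) : ¬a ∣ expSum n c :=
  not_dvd_expSum_of_prime_dvd_le hcn ha (by lia) (natDegree_expSum hcn ▸ hle)
    fun p hp hpc => (hc0 p hp hpc).trans h2

theorem irreducible_expSum {n : ℕ} (hn : 0 < n) {c : ℕ → ℤ} (hcn : c n = 1)
    (hc0 : ∀ p : ℕ, p.Prime → (p : ℤ) ∣ c 0 → p ≤ 2) {p : ℕ} (hp : p.Prime) (hpn : p ∣ n)
    (hpc : ¬(p : ℤ) ∣ c 0) : Irreducible (expSum n c) := by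
  by_contra hirr
  obtain ⟨q, hq, hq1, hqf⟩ := exists_monic_linear_dvd_of_not_irreducible
    (by rwa [natDegree_expSum hcn]) (fun _ => not_dvd_expSum_of_two_le_natDegree hcn hc0) hirr
  exact not_dvd_expSum_of_natDegree_eq_one hcn hp hpn hpc hq hq1 hqf

theorem prime_eq_two_of_dvd_two_pow {z : ℤ} {k : ℕ} (hz : z = 2 ^ k ∨ z = -2 ^ k) {p : ℕ}
    (hp : p.Prime) (hd : (p : ℤ) ∣ z) : p = 2 := by
  have hd' : (p : ℤ) ∣ 2 ^ k := by rcases hz with rfl | rfl <;> simpa using hd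
  exact (Nat.prime_dvd_prime_iff_eq hp Nat.prime_two).1
    (hp.dvd_of_dvd_pow (m := 2) (n := k) (by exact_mod_cast hd'))

theorem theorem1p1 (n : ℕ) (hn : 2 ≤ n) (c : ℕ → ℤ) (hcn : c n = 1)
    (k : ℕ) (hc0 : c 0 = 2 ^ k ∨ c 0 = -2 ^ k) :
    (Irreducible (expSum n c) ∨
      ∃ g : ℚ[X], Irreducible g ∧
        (n < 2 * g.natDegree ∨ (n = 2 ∧ g.natDegree = 1)) ∧ g.natDegree < n ∧
        ∃ (ε : Fin (n - g.natDegree) → ℤˣ) (t : Fin (n - g.natDegree) → ℕ),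
          expSum n c = g * ∏ i, (X + C (((ε i : ℤ) : ℚ) * 2 ^ t i))) ∧
    (((¬ ∃ s : ℕ, 0 < s ∧ n = 2 ^ s) ∨ c 0 = 1 ∨ c 0 = -1) →
      Irreducible (expSum n c)) := by
  have hdeg := natDegree_expSum hcn
  have htwo : ∀ p : ℕ, p.Prime → (p : ℤ) ∣ c 0 → p = 2 := fun _ => prime_eq_two_of_dvd_two_pow hc0
  have hle : ∀ p : ℕ, p.Prime → (p : ℤ) ∣ c 0 → p ≤ 2 := fun p hp hd => (htwo p hp hd).le
  have irred (h : (¬∃ s : ℕ, 0 < s ∧ n = 2 ^ s) ∨ c 0 = 1 ∨ c 0 = -1) :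
      Irreducible (expSum n c) := by
    obtain ⟨p, hp, hpn, hpc⟩ := exists_prime_dvd_not_dvd hn htwo h
    exact irreducible_expSum (by lia) hcn hle hp hpn hpc
  refine ⟨or_iff_not_imp_left.2 fun hirr => ?_, irred⟩
  have hn3 : n ≠ 3 := by
    rintro rfl
    exact hirr (irred (.inl fun ⟨s, hs, h⟩ =>
      absurd (h ▸ dvd_pow_self 2 hs.ne' : 2 ∣ 3) (by norm_num)))
  obtain ⟨q, g, hq, hq1, hg, hqg⟩ := exists_monic_linear_mul_irreducible (by lia) (by lia)
    (fun _ => not_dvd_expSum_of_two_le_natDegree hcn hle) hirr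
  obtain ⟨ε, t, rfl⟩ := exists_eq_X_add_C_of_dvd_expSum hcn htwo hq hq1 (Dvd.intro _ hqg.symm)
  have hgn : n = g.natDegree + 1 := by
    rw [← hdeg, hqg, hq.natDegree_mul' hg.ne_zero, hq1, add_comm]
  refine ⟨g, hg, by lia, by lia, fun _ => ε, fun _ => t, ?_⟩
  rw [hqg, Finset.prod_const, Finset.card_univ, Fintype.card_fin, hgn, Nat.add_sub_cancel_left]
  simp [mul_comm]
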